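/- Let $\sigma=\mathrm{Prop}\cup\{R_i\mid i\in I\}$ be a modal signature with finitely many unary proposition letters and finitely many binary actions. A $\sigma$-LTS $M_a$ is a (possibly infinite) $\sigma$-structure $M$ with one distinguished state $a$; it is image-finite if every state has only finitely many successors (along all actions together). Homomorphisms and isomorphisms are those of pointed structures. A directed path from $b_0$ to $b_k$ ($k\ge 0$) is a sequence of transitions $b_0\xrightarrow{i_1}b_1\xrightarrow{i_2}\cdots\xrightarrow{i_k}b_k$ with $R_{i_j}^M(b_{j-1},b_j)$ for all $j$. A $\sigma$-tree is a $\sigma$-LTS $T_c$ in which there is exactly one directed path from the root $c$ to each state; $\mathcal T_\sigma$ is the class of finite $\sigma$-trees. For $T_c\in\mathcal T_\sigma$ and image-finite $M_a$, $\hom_{\mathbb N}(T_c,M_a)\in\mathbb N$ is the (finite) number of homomorphisms from $T_c$ to $M_a$. The unraveling $\mathtt{unr}(M_a)$ is the $\sigma$-LTS whose states are the directed paths of $M$ starting at $a$, whose distinguished state is the empty path, in which $R_i$ holds of $(w,w')$ iff $w'$ extends $w$ by exactly one transition, and that transition has action $R_i$, and in which $p$ holds at $w$ iff $p$ holds in $M$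 at the last state of $w$. Graded modal logic $\mathrm{ML}_\#$ has the formulas $$\varphi ::= p\mid\top\mid\varphi\wedge\varphi\mid\varphi\vee\varphi\mid\neg\varphi\mid\Diamond_i\varphi\mid\Box_i\varphi\mid\Diamond_i^{\ge k}\varphi\qquad(p\in\mathrm{Prop},\ i\in I,\ k\ge 1)$$ with the usual semantics, where $\Diamond_i^{\ge k}\varphi$ says that at least $k$ $R_i$-successors satisfy $\varphi$. **Claim.** For image-finite $\sigma$-LTSs $M_a$ and $N_b$ the following are equivalent: 1. $\hom_{\mathbb N}(T_c,M_a)=\hom_{\mathbb N}(T_c,N_b)$ for every $T_c\in\mathcal T_\sigma$; 2. $\mathtt{unr}(M_a)\cong\mathtt{unr}(N_b)$; 3. $M_a$ and $N_b$ satisfy the same formulas of $\mathrm{ML}_\#$. If moreover in each of $M$ and $N$ no two distinct actions hold of the same pair of states (for instance, if there is only one action), then the same three-way equivalence holds when the actions are forgotten along directed paths, that is, when a $\sigma$-tree is required to have exactly one sequence of states $c=b_0,b_1,\dots,b_k=m$, with some action from each $b_j$ to $b_{j+1}$, from the root $c$ to each state $m$, and when the states of $\mathtt{unr}(M_a)$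 are the sequences $w=\langle w_1,\dots,w_n\rangle$ of states of $M$ with $w_1=a$ and some action from each $w_j$ to $w_{j+1}$, with $R_i$ holding of $(w,w^\frown\langle u\rangle)$ iff $R_i^M(w_n,u)$ and $p$ holding at $w$ iff $p^M(w_n)$. -/

import Mathlib

universe uP uI u v

/-- A labelled transition system over the modal signature with proposition letters `P` and
actions `I`: a first-order structure with one distinguished state. -/
structure LTS (P : Type uP) (I : Type uI) where
  State : Type u
  prop : P → State → Prop
  act : I → State → State → Prop
  pt : State

/-- Formulas of graded modal logic: the basic multimodal language (with the constant `⊤`)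
together with the graded modalities `◇_i^{≥ k}`, `k ≥ 1`. -/
inductive GMLFormula (P : Type uP) (I : Type uI) where
  | prop (p : P) : GMLFormula P I
  | top : GMLFormula P I
  | and (φ ψ : GMLFormula P I) : GMLFormula P I
  | or (φ ψ : GMLFormula P I) : GMLFormula P I
  | neg (φ : GMLFormula P I) : GMLFormula P I
  | dia (i : I) (φ : GMLFormula P I) : GMLFormula P I
  | box (i : I) (φ : GMLFormula P I) : GMLFormula P I
  | gdia (i : I) (k : ℕ+) (φ : GMLFormula P I) : GMLFormula P I

namespace LTS

variable {P : Type uP} {I : Type uI}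

/-- Some action leads from `m` to `n`. -/
def Succ (M : LTS.{uP, uI, u} P I) (m n : M.State) : Prop := ∃ i, M.act i m n

def ImageFinite (M : LTS.{uP, uI, u} P I) : Prop := ∀ m, {n | M.Succ m n}.Finite

/-- Homomorphisms of pointed structures. -/
@[ext] structure Hom (M : LTS.{uP, uI, u} P I) (N : LTS.{uP, uI, v} P I) where
  toFun : M.State → N.State
  map_pt : toFun M.pt = N.pt
  map_prop : ∀ p m, M.prop p m → N.prop p (toFun m)
  map_act : ∀ i m n, M.act i m n → N.act i (toFun m) (toFun n)

/-- There is a bijective homomorphism whose inverse is a homomorphism. -/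
def Isomorphic (M : LTS.{uP, uI, u} P I) (N : LTS.{uP, uI, v} P I) : Prop :=
  ∃ (h : Hom M N) (g : Hom N M),
    Function.LeftInverse g.toFun h.toFun ∧ Function.RightInverse g.toFun h.toFun

/-- The homomorphism count over the semiring of natural numbers. It is only used for finite trees
`T` and image-finite `M`, where `Hom T M` is finite (`finite_hom_of_isTree`,
`finite_hom_of_isPairTree` below). -/
noncomputable def homCount (T : LTS.{uP, uI, u} P I) (M : LTS.{uP, uI, v} P I) : ℕ :=
  Nat.card (Hom T M)

/-- Equality of the left homomorphism vectors of `M` and `N` restricted to the class of finite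
structures satisfying `C`. (Every finite structure is isomorphic to one in `Type`.) -/
def HomVectorEq (C : LTS.{uP, uI, 0} P I → Prop)
    (M : LTS.{uP, uI, u} P I) (N : LTS.{uP, uI, v} P I) : Prop :=
  ∀ T : LTS.{uP, uI, 0} P I, Finite T.State → C T → homCount T M = homCount T N

/-! ### Directed paths as sequences of labelled transitions -/

/-- `[(i₁, b₁), …, (iₖ, bₖ)]` describes a directed path `b₀ -i₁→ b₁ -i₂→ ⋯ -iₖ→ bₖ` from `b₀`. -/
def IsRun (M : LTS.{uP, uI, u} P I) : M.State → List (I × M.State) → Prop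
  | _, [] => True
  | m, (i, n) :: l => M.act i m n ∧ M.IsRun n l

/-- The last state of a directed path from `m`. -/
def endpoint (M : LTS.{uP, uI, u} P I) : M.State → List (I × M.State) → M.State
  | m, [] => m
  | _, (_, n) :: l => M.endpoint n l

/-- A tree: exactly one directed path (sequence of transitions) from the root to each state. -/
def IsTree (M : LTS.{uP, uI, u} P I) : Prop :=
  ∀ m, ∃! l : List (I × M.State), M.IsRun M.pt l ∧ M.endpoint M.pt l = m

/-- The unraveling: its states are the directed paths from the distinguished state. -/
def unravel (M : LTS.{uP, uI, u} P I) : LTS.{uP, uI, max uI u} P I where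
  State := {l : List (I × M.State) // M.IsRun M.pt l}
  prop p l := M.prop p (M.endpoint M.pt l.1)
  act i l l' := ∃ n, M.act i (M.endpoint M.pt l.1) n ∧ l'.1 = l.1 ++ [(i, n)]
  pt := ⟨[], trivial⟩

/-! ### Directed paths as sequences of states, with the actions forgotten -/

/-- `l = [b₀, …, bₖ]` with `b₀ = m` and, for each `j < k`, some action from `bⱼ` to `bⱼ₊₁`. -/
def IsStateRun (M : LTS.{uP, uI, u} P I) (m : M.State) (l : List M.State) : Prop :=
  l.head? = some m ∧ l.IsChain M.Succ

/-- Exactly one sequence of states leads from the root to each state; a transition of such a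
tree may carry more than one action. -/
def IsPairTree (M : LTS.{uP, uI, u} P I) : Prop :=
  ∀ m, ∃! l : List M.State, M.IsStateRun M.pt l ∧ l.getLast? = some m

/-- The unraveling whose states are the sequences of states along directed paths. -/
def stateUnravel (M : LTS.{uP, uI, u} P I) : LTS.{uP, uI, u} P I where
  State := {l : List M.State // M.IsStateRun M.pt l}
  prop p l := ∃ m, l.1.getLast? = some m ∧ M.prop p m
  act i l l' := ∃ m n, l.1.getLast? = some m ∧ M.act i m n ∧ l'.1 = l.1 ++ [n]
  pt := ⟨[M.pt], rfl, List.isChain_singleton _⟩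

/-- No two distinct actions lead from one state to the same state. -/
def ActionsDisjoint (M : LTS.{uP, uI, u} P I) : Prop :=
  ∀ i j m n, M.act i m n → M.act j m n → i = j

/-! ### Graded modal equivalence -/

/-- Truth of a graded modal formula at a state. -/
def Sat (M : LTS.{uP, uI, u} P I) : GMLFormula P I → M.State → Prop
  | .prop p, m => M.prop p m
  | .top, _ => True
  | .and φ ψ, m => M.Sat φ m ∧ M.Sat ψ m
  | .or φ ψ, m => M.Sat φ m ∨ M.Sat ψ m
  | .neg φ, m => ¬ M.Sat φ m
  | .dia i φ, m => ∃ n, M.act i m n ∧ M.Sat φ n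
  | .box i φ, m => ∀ n, M.act i m n → M.Sat φ n
  | .gdia i k φ, m => ((k : ℕ) : ℕ∞) ≤ {n | M.act i m n ∧ M.Sat φ n}.encard

/-- `M` and `N` satisfy the same formulas of graded modal logic. -/
def GMLEquiv (M : LTS.{uP, uI, u} P I) (N : LTS.{uP, uI, v} P I) : Prop :=
  ∀ φ : GMLFormula P I, M.Sat φ M.pt ↔ N.Sat φ N.pt

/-! ### The homomorphism counts are well defined -/

theorem finite_hom_of_reachable (T : LTS.{uP, uI, u} P I) (M : LTS.{uP, uI, v} P I)
    [Finite T.State] (hT : ∀ m, Relation.ReflTransGen T.Succ T.pt m) (hM : M.ImageFinite) :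
    Finite (Hom T M) := by
  have key : ∀ m, {x | ∃ h : Hom T M, h.toFun m = x}.Finite := by
    intro m
    induction hT m with
    | refl =>
      refine (Set.finite_singleton M.pt).subset ?_
      rintro x ⟨h, rfl⟩
      exact h.map_pt
    | tail _ hs ih =>
      obtain ⟨i, hi⟩ := hs
      refine (ih.biUnion fun y _ => hM y).subset ?_
      rintro x ⟨h, rfl⟩
      exact Set.mem_biUnion ⟨h, rfl⟩ ⟨i, h.map_act _ _ _ hi⟩
  have : ∀ m, Finite {x | ∃ h : Hom T M, h.toFun m = x} := fun m => (key m).to_subtype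
  refine Finite.of_injective
    (fun (h : Hom T M) (m : T.State) =>
      (⟨h.toFun m, h, rfl⟩ : {x | ∃ h : Hom T M, h.toFun m = x})) ?_
  intro h g e
  ext m
  exact congrArg Subtype.val (congrFun e m)

theorem IsRun.reachable {M : LTS.{uP, uI, u} P I} :
    ∀ (l : List (I × M.State)) (m : M.State), M.IsRun m l →
      Relation.ReflTransGen M.Succ m (M.endpoint m l)
  | [], _, _ => .refl
  | (i, _) :: l, _, h => .head ⟨i, h.1⟩ (IsRun.reachable l _ h.2)

theorem IsStateRun.reachable {M : LTS.{uP, uI, u} P I} :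
    ∀ (l : List M.State) (m n : M.State), M.IsStateRun m l → l.getLast? = some n →
      Relation.ReflTransGen M.Succ m n
  | [], _, _, h, _ => by simp [IsStateRun] at h
  | [a], m, n, h, e => by
    simp only [IsStateRun, List.head?_cons, Option.some.injEq] at h
    simp only [List.getLast?_singleton, Option.some.injEq] at e
    rw [← h.1, e]
  | a :: b :: l, m, n, h, e => by
    simp only [IsStateRun, List.head?_cons, Option.some.injEq, List.isChain_cons_cons] at h
    obtain ⟨rfl, hab, hl⟩ := h
    exact .head hab (IsStateRun.reachable (b :: l) b n ⟨rfl, hl⟩ (by simpa using e))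

theorem finite_hom_of_isTree (T : LTS.{uP, uI, u} P I) (M : LTS.{uP, uI, v} P I)
    [Finite T.State] (hT : T.IsTree) (hM : M.ImageFinite) : Finite (Hom T M) :=
  finite_hom_of_reachable T M
    (fun m => by obtain ⟨l, ⟨h, rfl⟩, _⟩ := hT m; exact h.reachable) hM

theorem finite_hom_of_isPairTree (T : LTS.{uP, uI, u} P I) (M : LTS.{uP, uI, v} P I)
    [Finite T.State] (hT : T.IsPairTree) (hM : M.ImageFinite) : Finite (Hom T M) :=
  finite_hom_of_reachable T M
    (fun m => by obtain ⟨l, ⟨h, e⟩, _⟩ := hT m; exact h.reachable _ _ _ e) hM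

end LTS

/-! An unraveling is a universal covering. Call a homomorphism a covering if it is a local
isomorphism: it reflects proposition letters and matches the successors of each state with those of
its image, action by action. Homomorphisms from trees lift uniquely along coverings, so coverings
preserve the numbers of homomorphisms from trees; they also preserve graded modal formulas, and any
two trees covering the same structure are isomorphic. Since `unr(M)` is a tree covering `M`,
isomorphic unravelings give the same counts and the same formulas.

Conversely, if a graded bisimulation relates `M` and `N`, then its graph covers both, whence
`unr(M) ≅ unr(N)`. Both kinds of data yield such a bisimulation for the same reason. The counts
`T ↦ hom(T, M_m)` are multiplicative for gluing trees at their roots, and the truth values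
`φ ↦ [M, m ⊨ φ]` are multiplicative for conjunction. The data at `m` also determine, for each
action, the sum of these characters over the successors of `m`: attach `T` below a new root,
respectively count the successors satisfying `φ` by graded modalities. By linear independence of
characters, equal sums have the same terms, so the successors can be matched.

Forgetting the actions along paths changes nothing if distinct actions are disjoint, since
then the sequences of states also form a tree covering `M`. -/

universe w

theorem existsUnique_subtype_iff {α : Type*} {p q : α → Prop} :
    (∃! a : {a // p a}, q a) ↔ ∃! a, p a ∧ q a :=
  ⟨fun ⟨a, ha, h⟩ => ⟨a, ⟨a.2, ha⟩, fun b hb => congrArg Subtype.val (h ⟨b, hb.1⟩ hb.2)⟩,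
    fun ⟨a, ha, h⟩ => ⟨⟨a, ha.1⟩, ha.2, fun b hb => Subtype.ext (h b ⟨b.2, hb⟩)⟩⟩

/-- By linear independence of characters, the sum determines the multiset of summands. -/
theorem exists_equiv_of_finsum_monoidHom_eq {X Y A L : Type*} [Finite X] [Finite Y] [MulOneClass A]
    [CommRing L] [IsDomain L] [CharZero L] (F : X → A →* L) (G : Y → A →* L)
    (h : ∀ a, ∑ᶠ x, F x a = ∑ᶠ y, G y a) : ∃ e : X ≃ Y, ∀ x, G (e x) = F x := by
  classical
  cases nonempty_fintype X
  cases nonempty_fintype Y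
  simp only [finsum_eq_sum_of_fintype] at h
  have single_sum_eq : ∑ x, Finsupp.single (F x) (1 : L) = ∑ y, Finsupp.single (G y) (1 : L) := by
    refine linearIndependent_monoidHom A L ?_
    ext a
    simpa using h a
  have card_fiber_eq (χ : A →* L) :
      Fintype.card {x // F x = χ} = Fintype.card {y // G y = χ} := by
    have coeff_eq := DFunLike.congr_fun single_sum_eq χ
    simp only [Finsupp.finsetSum_apply, Finsupp.single_apply, Finset.sum_boole] at coeff_eq
    rw [Fintype.card_subtype, Fintype.card_subtype]
    exact_mod_cast coeff_eq
  exact ⟨.ofFiberEquiv fun χ => Fintype.equivOfCardEq (card_fiber_eq χ),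
    Equiv.ofFiberEquiv_map _⟩

/-- The conjunction of a list of formulas. Lists are written as elements of the free monoid because
their truth values are multiplicative (`LTS.truth`). -/
def GMLFormula.conj {P : Type uP} {I : Type uI} (w : FreeMonoid (GMLFormula P I)) :
    GMLFormula P I :=
  w.toList.foldr .and .top

namespace LTS

variable {P : Type uP} {I : Type uI} {K : LTS.{uP, uI, w} P I} {M : LTS.{uP, uI, u} P I}
  {N : LTS.{uP, uI, v} P I}

/-! ### Homomorphisms and isomorphisms -/

namespace Hom

/-- The identity homomorphism. -/
def id (M : LTS.{uP, uI, u} P I) : Hom M M := ⟨_root_.id, rfl, fun _ _ h => h, fun _ _ _ h => h⟩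

/-- The composition `g ∘ f` of homomorphisms. -/
def comp (g : Hom M N) (f : Hom K M) : Hom K N where
  toFun := g.toFun ∘ f.toFun
  map_pt := (congrArg g.toFun f.map_pt).trans g.map_pt
  map_prop p m h := g.map_prop p _ (f.map_prop p m h)
  map_act i m n h := g.map_act i _ _ (f.map_act i m n h)

theorem reachable (f : Hom M N) {m : M.State} (h : Relation.ReflTransGen M.Succ M.pt m) :
    Relation.ReflTransGen N.Succ N.pt (f.toFun m) :=
  f.map_pt ▸ h.lift f.toFun fun _ _ ⟨i, hi⟩ => ⟨i, f.map_act i _ _ hi⟩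

end Hom

theorem Isomorphic.symm : Isomorphic M N → Isomorphic N M := fun ⟨f, g, hgf, hfg⟩ =>
  ⟨g, f, hfg, hgf⟩

theorem Isomorphic.trans : Isomorphic K M → Isomorphic M N → Isomorphic K N :=
  fun ⟨f, g, hgf, hfg⟩ ⟨f', g', hgf', hfg'⟩ =>
    ⟨f'.comp f, g.comp g', hgf'.comp hgf, hfg'.comp hfg⟩

/-! ### Arborescences -/

/-- Rooted directed trees, described locally: every state is reachable from the distinguished one,
which has no incoming transition, and every state has at most one incoming transition. This is
equivalent to `IsTree` (`isTree_iff_isArborescence`), but easier to check. -/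
structure IsArborescence (T : LTS.{uP, uI, u} P I) : Prop where
  reachable : ∀ m, Relation.ReflTransGen T.Succ T.pt m
  not_act_pt : ∀ i m, ¬ T.act i m T.pt
  act_unique : ∀ {i j m m' n}, T.act i m n → T.act j m' n → i = j ∧ m = m'

theorem IsArborescence.actionsDisjoint (hM : M.IsArborescence) : M.ActionsDisjoint :=
  fun _ _ _ _ hi hj => (hM.act_unique hi hj).1

/-! ### Coverings -/

/-- Local isomorphisms: homomorphisms which reflect proposition letters and restrict, for each
action and each state, to a bijection between the successors. They play the role of covering maps,
with unravelings as universal coverings. -/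
structure IsCovering (f : Hom M N) : Prop where
  prop_of_map : ∀ p m, N.prop p (f.toFun m) → M.prop p m
  injOn : ∀ i m, Set.InjOn f.toFun {m' | M.act i m m'}
  surjOn : ∀ i m, Set.SurjOn f.toFun {m' | M.act i m m'} {n | N.act i (f.toFun m) n}

/-- `f.Lifts g t m` says that `m` is the end of a lift, along `f` and from the distinguished state,
of the image under `g` of some path from the root of `T` to `t`. -/
inductive Hom.Lifts {T : LTS.{uP, uI, w} P I} (f : Hom M N) (g : Hom T N) :
    T.State → M.State → Prop
  | pt : Lifts f g T.pt M.pt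
  | act {i s t m m'} : Lifts f g s m → T.act i s t → M.act i m m' → f.toFun m' = g.toFun t →
      Lifts f g t m'

theorem Hom.Lifts.map_eq {T : LTS.{uP, uI, w} P I} {f : Hom M N} {g : Hom T N} {t : T.State}
    {m : M.State} : f.Lifts g t m → f.toFun m = g.toFun t
  | .pt => f.map_pt.trans g.map_pt.symm
  | .act _ _ _ h => h

namespace IsCovering

section Lifting

variable {T : LTS.{uP, uI, w} P I} {f : Hom M N}

theorem exists_lifts_of_act (hf : IsCovering f) {g : Hom T N} {i : I} {s t : T.State}
    {m : M.State} (hm : f.Lifts g s m) (h : T.act i s t) :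
    ∃ m', M.act i m m' ∧ f.Lifts g t m' := by
  obtain ⟨m', hm', e⟩ := hf.surjOn i m
    (show N.act i (f.toFun m) (g.toFun t) from hm.map_eq ▸ g.map_act i s t h)
  exact ⟨m', hm', hm.act h hm' e⟩

theorem exists_lifts (hf : IsCovering f) (hT : T.IsArborescence) (g : Hom T N) (t : T.State) :
    ∃ m, f.Lifts g t m := by
  induction hT.reachable t with
  | refl => exact ⟨_, .pt⟩
  | tail _ h ih =>
    obtain ⟨m, hm⟩ := ih
    obtain ⟨i, hi⟩ := h
    obtain ⟨m', -, hm'⟩ := hf.exists_lifts_of_act hm hi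
    exact ⟨m', hm'⟩

theorem lifts_unique (hf : IsCovering f) (hT : T.IsArborescence) {g : Hom T N} {t : T.State}
    {m m' : M.State} (hm : f.Lifts g t m) (hm' : f.Lifts g t m') : m = m' := by
  induction hm generalizing m' with
  | pt =>
    cases hm' with
    | pt => rfl
    | act _ h => exact absurd h (hT.not_act_pt _ _)
  | act _ h hact e ih =>
    cases hm' with
    | pt => exact absurd h (hT.not_act_pt _ _)
    | act hs h' hact' e' =>
      obtain ⟨rfl, rfl⟩ := hT.act_unique h h'
      obtain rfl := ih hs
      exact hf.injOn _ _ hact hact' (e.trans e'.symm)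

theorem exists_comp_eq (hf : IsCovering f) (hT : T.IsArborescence) (g : Hom T N) :
    ∃ h : Hom T M, f.comp h = g := by
  choose h hh using hf.exists_lifts hT g
  refine ⟨⟨h, hf.lifts_unique hT (hh _) .pt, fun p t ht => ?_, fun i s t hst => ?_⟩,
    Hom.ext (funext fun t => (hh t).map_eq)⟩
  · exact hf.prop_of_map p _ ((hh t).map_eq ▸ g.map_prop p t ht)
  · obtain ⟨m, hm, hl⟩ := hf.exists_lifts_of_act (hh s) hst
    rwa [hf.lifts_unique hT (hh t) hl]

theorem comp_injective (hf : IsCovering f) (hT : ∀ t, Relation.ReflTransGen T.Succ T.pt t) :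
    Function.Injective (f.comp : Hom T M → Hom T N) := by
  intro g h e
  ext t
  induction hT t with
  | refl => exact g.map_pt.trans h.map_pt.symm
  | @tail s t _ hst ih =>
    obtain ⟨i, hi⟩ := hst
    exact hf.injOn i (g.toFun s) (g.map_act i s t hi) (ih ▸ h.map_act i s t hi)
      (congrFun (congrArg Hom.toFun e) t)

theorem homCount_eq (hf : IsCovering f) (hT : T.IsArborescence) : homCount T M = homCount T N :=
  Nat.card_congr <| .ofBijective _ ⟨hf.comp_injective hT.reachable, hf.exists_comp_eq hT⟩

end Lifting

theorem comp {g : Hom M N} {f : Hom K M} (hg : IsCovering g) (hf : IsCovering f) :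
    IsCovering (g.comp f) where
  prop_of_map p k h := hf.prop_of_map p k (hg.prop_of_map p _ h)
  injOn i k := (hg.injOn i _).comp (hf.injOn i k) fun _ => f.map_act i _ _
  surjOn i k := (hg.surjOn i _).comp (hf.surjOn i k)

theorem of_inverse {f : Hom M N} {g : Hom N M} (hgf : Function.LeftInverse g.toFun f.toFun)
    (hfg : Function.RightInverse g.toFun f.toFun) : IsCovering f where
  prop_of_map p m h := hgf m ▸ g.map_prop p _ h
  injOn _ _ := hgf.injective.injOn
  surjOn i m n hn := ⟨g.toFun n, hgf m ▸ g.map_act i _ _ hn, hfg n⟩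

/-- Both structures are universal coverings of `N`, so each covering lifts along the other. -/
theorem isomorphic {f : Hom K N} {g : Hom M N} (hf : IsCovering f) (hg : IsCovering g)
    (hK : K.IsArborescence) (hM : M.IsArborescence) : Isomorphic K M := by
  obtain ⟨h, hh⟩ := hg.exists_comp_eq hK f
  obtain ⟨k, hk⟩ := hf.exists_comp_eq hM g
  have hkh : k.comp h = Hom.id K := hf.comp_injective hK.reachable <|
    show (f.comp k).comp h = f from hk ▸ hh
  have hhk : h.comp k = Hom.id M := hg.comp_injective hM.reachable <|
    show (g.comp h).comp k = g from hh ▸ hk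
  exact ⟨h, k, congrFun (congrArg Hom.toFun hkh), congrFun (congrArg Hom.toFun hhk)⟩

theorem bijective_iff_isArborescence {f : Hom M N} (hf : IsCovering f) (hM : M.IsArborescence) :
    Function.Bijective f.toFun ↔ N.IsArborescence := by
  constructor
  · rintro ⟨inj, surj⟩
    refine ⟨fun n => ?_, fun i n h => ?_, fun {i j n n' l} h h' => ?_⟩
    · obtain ⟨m, rfl⟩ := surj n
      exact f.reachable (hM.reachable m)
    · obtain ⟨m, rfl⟩ := surj n
      obtain ⟨m', hm', e⟩ := hf.surjOn i m h
      exact hM.not_act_pt i m (inj (e.trans f.map_pt.symm) ▸ hm')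
    · obtain ⟨m, rfl⟩ := surj n
      obtain ⟨m', rfl⟩ := surj n'
      obtain ⟨k, hk, rfl⟩ := hf.surjOn i m h
      obtain ⟨k', hk', e⟩ := hf.surjOn j m' h'
      obtain rfl := inj e
      exact (hM.act_unique hk hk').imp_right (congrArg f.toFun)
  · intro hN
    obtain ⟨s, hs⟩ := hf.exists_comp_eq hN (Hom.id N)
    have hsf : s.comp f = Hom.id M := hf.comp_injective hM.reachable <|
      show (f.comp s).comp f = f by rw [hs]; rfl
    exact Function.bijective_iff_has_inverse.2
      ⟨s.toFun, congrFun (congrArg Hom.toFun hsf), congrFun (congrArg Hom.toFun hs)⟩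

theorem sat_iff {f : Hom M N} (hf : IsCovering f) (φ : GMLFormula P I) (m : M.State) :
    N.Sat φ (f.toFun m) ↔ M.Sat φ m := by
  induction φ generalizing m with
  | prop p => exact ⟨hf.prop_of_map p m, f.map_prop p m⟩
  | top => exact Iff.rfl
  | and φ ψ hφ hψ => exact and_congr (hφ m) (hψ m)
  | or φ ψ hφ hψ => exact or_congr (hφ m) (hψ m)
  | neg φ hφ => exact not_congr (hφ m)
  | dia i φ hφ =>
    constructor
    · rintro ⟨_, hn, hsat⟩
      obtain ⟨m', hm', rfl⟩ := hf.surjOn i m hn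
      exact ⟨m', hm', (hφ m').1 hsat⟩
    · rintro ⟨m', hm', hsat⟩
      exact ⟨_, f.map_act i m m' hm', (hφ m').2 hsat⟩
  | box i φ hφ =>
    constructor
    · exact fun h m' hm' => (hφ m').1 (h _ (f.map_act i m m' hm'))
    · intro h _ hn
      obtain ⟨m', hm', rfl⟩ := hf.surjOn i m hn
      exact (hφ m').2 (h m' hm')
  | gdia i k φ hφ =>
    have image_eq : f.toFun '' {m' | M.act i m m' ∧ M.Sat φ m'} =
        {n | N.act i (f.toFun m) n ∧ N.Sat φ n} := by
      ext n
      constructor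
      · rintro ⟨m', ⟨hm', hsat⟩, rfl⟩
        exact ⟨f.map_act i m m' hm', (hφ m').2 hsat⟩
      · rintro ⟨hn, hsat⟩
        obtain ⟨m', hm', rfl⟩ := hf.surjOn i m hn
        exact ⟨m', ⟨hm', (hφ m').1 hsat⟩, rfl⟩
    rw [Sat, Sat, ← image_eq, ((hf.injOn i m).mono fun _ h => h.1).encard_image]

theorem gmlEquiv {f : Hom M N} (hf : IsCovering f) : GMLEquiv M N := fun φ => by
  rw [← hf.sat_iff, f.map_pt]

end IsCovering

/-! ### The unraveling -/

theorem isRun_append (l l' : List (I × M.State)) (m : M.State) :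
    M.IsRun m (l ++ l') ↔ M.IsRun m l ∧ M.IsRun (M.endpoint m l) l' := by
  induction l generalizing m with
  | nil => simp [IsRun, endpoint]
  | cons a l ih => simp [IsRun, endpoint, ih, and_assoc]

theorem endpoint_append (l l' : List (I × M.State)) (m : M.State) :
    M.endpoint m (l ++ l') = M.endpoint (M.endpoint m l) l' := by
  induction l generalizing m with
  | nil => rfl
  | cons a _ ih => exact ih a.2

theorem isRun_concat {l : List (I × M.State)} {m n : M.State} {i : I} :
    M.IsRun m (l ++ [(i, n)]) ↔ M.IsRun m l ∧ M.act i (M.endpoint m l) n := by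
  simp [isRun_append, IsRun]

theorem endpoint_concat (l : List (I × M.State)) (m n : M.State) (i : I) :
    M.endpoint m (l ++ [(i, n)]) = n :=
  endpoint_append l _ m

theorem isArborescence_unravel (M : LTS.{uP, uI, u} P I) : M.unravel.IsArborescence where
  reachable := by
    rintro ⟨l, hl⟩
    induction l using List.reverseRecOn with
    | nil => exact .refl
    | append_singleton l a ih =>
      have hl' := isRun_concat.1 hl
      exact .tail (ih hl'.1) ⟨a.1, a.2, hl'.2, rfl⟩
  not_act_pt := by
    rintro i l ⟨n, -, h⟩
    exact List.append_ne_nil_of_right_ne_nil l.1 (List.cons_ne_nil _ _) h.symm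
  act_unique := by
    rintro i j l l' k ⟨n, -, h⟩ ⟨n', -, h'⟩
    obtain ⟨e, e'⟩ := List.append_inj' (h.symm.trans h') rfl
    exact ⟨congrArg Prod.fst (List.singleton_inj.1 e'), Subtype.ext e⟩

/-- The homomorphism from the unraveling that sends a directed path to its last state. -/
def unravelProj (M : LTS.{uP, uI, u} P I) : Hom M.unravel M where
  toFun l := M.endpoint M.pt l.1
  map_pt := rfl
  map_prop _ _ h := h
  map_act := by
    rintro i _ ⟨_, _⟩ ⟨n, h, rfl⟩
    rwa [endpoint_concat]

theorem isCovering_unravelProj (M : LTS.{uP, uI, u} P I) : IsCovering M.unravelProj where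
  prop_of_map _ _ h := h
  injOn := by
    rintro i _ ⟨_, _⟩ ⟨n, -, rfl⟩ ⟨_, _⟩ ⟨n', -, rfl⟩ h
    simp only [unravelProj, endpoint_concat] at h
    subst h
    rfl
  surjOn i l n hn :=
    ⟨⟨l.1 ++ [(i, n)], isRun_concat.2 ⟨l.2, hn⟩⟩, ⟨n, hn, rfl⟩, endpoint_concat _ _ _ _⟩

theorem IsCovering.isomorphic_unravel {f : Hom M N} (hf : IsCovering f) :
    Isomorphic M.unravel N.unravel :=
  (hf.comp M.isCovering_unravelProj).isomorphic N.isCovering_unravelProj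
    M.isArborescence_unravel N.isArborescence_unravel

theorem isTree_iff_isArborescence : M.IsTree ↔ M.IsArborescence := by
  rw [← M.isCovering_unravelProj.bijective_iff_isArborescence M.isArborescence_unravel,
    Function.bijective_iff_existsUnique]
  exact forall_congr' fun _ => existsUnique_subtype_iff.symm

theorem homVectorEq_isTree_of_isomorphic_unravel (h : Isomorphic M.unravel N.unravel) :
    HomVectorEq IsTree M N := by
  obtain ⟨f, g, hgf, hfg⟩ := h
  intro T _ hT
  have hT := isTree_iff_isArborescence.1 hT
  rw [← M.isCovering_unravelProj.homCount_eq hT, (IsCovering.of_inverse hgf hfg).homCount_eq hT,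
    N.isCovering_unravelProj.homCount_eq hT]

theorem gmlEquiv_of_isomorphic_unravel (h : Isomorphic M.unravel N.unravel) : GMLEquiv M N := by
  obtain ⟨f, g, hgf, hfg⟩ := h
  exact fun φ => (M.isCovering_unravelProj.gmlEquiv φ).symm.trans
    ((N.isCovering_unravelProj.comp (.of_inverse hgf hfg)).gmlEquiv φ)

/-! ### The unraveling along sequences of states -/

theorem isStateRun_concat {l : List M.State} {m n : M.State} :
    M.IsStateRun m (l ++ [n]) ↔
      (l = [] ∧ n = m) ∨ ∃ k, M.IsStateRun m l ∧ l.getLast? = some k ∧ M.Succ k n := by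
  rcases List.eq_nil_or_concat' l with rfl | ⟨l, k, rfl⟩
  · simp [IsStateRun]
  · simp [IsStateRun, List.isChain_append, and_assoc, and_comm (a := M.Succ k n)]

theorem isArborescence_stateUnravel (hM : M.ActionsDisjoint) :
    M.stateUnravel.IsArborescence where
  reachable := by
    rintro ⟨l, hl⟩
    induction l using List.reverseRecOn with
    | nil => simp [IsStateRun] at hl
    | append_singleton l n ih =>
      obtain ⟨rfl, rfl⟩ | ⟨k, hl', hk, i, hi⟩ := isStateRun_concat.1 hl
      · exact .refl
      · exact .tail (ih hl') ⟨i, k, n, hk, hi, rfl⟩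
  not_act_pt := by
    rintro i l ⟨m, n, hm, -, h⟩
    have : l.1 = [] := (List.append_inj' (s₁ := []) h rfl).1.symm
    simp [this] at hm
  act_unique := by
    rintro i j l l' k ⟨m, n, hm, h, e⟩ ⟨m', n', hm', h', e'⟩
    obtain ⟨hl, hn⟩ := List.append_inj' (e.symm.trans e') rfl
    obtain rfl : l = l' := Subtype.ext hl
    obtain rfl : m = m' := Option.some.inj (hm.symm.trans hm')
    obtain rfl := List.singleton_inj.1 hn
    exact ⟨hM i j m n h h', rfl⟩

theorem IsStateRun.ne_nil {l : List M.State} {m : M.State} (h : M.IsStateRun m l) : l ≠ [] := by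
  rintro rfl
  simp [IsStateRun] at h

/-- The homomorphism from `stateUnravel` that sends a sequence of states to its last entry. -/
def stateUnravelProj (M : LTS.{uP, uI, u} P I) : Hom M.stateUnravel M where
  toFun l := l.1.getLast l.2.ne_nil
  map_pt := rfl
  map_prop := by
    rintro p l ⟨m, hm, h⟩
    rwa [List.getLast_of_getLast?_eq_some hm]
  map_act := by
    rintro i l ⟨_, _⟩ ⟨m, n, hm, h, rfl⟩
    rwa [List.getLast_of_getLast?_eq_some hm, List.getLast_concat]

theorem isCovering_stateUnravelProj (M : LTS.{uP, uI, u} P I) :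
    IsCovering M.stateUnravelProj where
  prop_of_map _ l h := ⟨_, List.getLast?_eq_some_getLast l.2.ne_nil, h⟩
  injOn := by
    rintro i _ ⟨_, _⟩ ⟨-, n, -, -, rfl⟩ ⟨_, _⟩ ⟨-, n', -, -, rfl⟩ h
    simp only [stateUnravelProj, List.getLast_concat] at h
    subst h
    rfl
  surjOn i l n hn :=
    have hlast := List.getLast?_eq_some_getLast l.2.ne_nil
    ⟨⟨l.1 ++ [n], isStateRun_concat.2 (.inr ⟨_, l.2, hlast, i, hn⟩)⟩, ⟨_, n, hlast, hn, rfl⟩,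
      List.getLast_concat⟩

theorem ActionsDisjoint.isomorphic_stateUnravel_unravel (hM : M.ActionsDisjoint) :
    Isomorphic M.stateUnravel M.unravel :=
  M.isCovering_stateUnravelProj.isomorphic M.isCovering_unravelProj
    (isArborescence_stateUnravel hM) M.isArborescence_unravel

theorem isomorphic_stateUnravel_iff (hM : M.ActionsDisjoint) (hN : N.ActionsDisjoint) :
    Isomorphic M.stateUnravel N.stateUnravel ↔ Isomorphic M.unravel N.unravel :=
  have eM := hM.isomorphic_stateUnravel_unravel
  have eN := hN.isomorphic_stateUnravel_unravel
  ⟨fun h => (eM.symm.trans h).trans eN, fun h => (eM.trans h).trans eN.symm⟩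

theorem ActionsDisjoint.isPairTree_iff_isArborescence (hM : M.ActionsDisjoint) :
    M.IsPairTree ↔ M.IsArborescence := by
  rw [← M.isCovering_stateUnravelProj.bijective_iff_isArborescence
    (isArborescence_stateUnravel hM), Function.bijective_iff_existsUnique]
  exact forall_congr' fun m => existsUnique_subtype_iff.symm.trans <|
    existsUnique_congr fun l => (List.getLast_eq_iff_getLast?_eq_some l.2.ne_nil).symm

theorem ActionsDisjoint.of_hom (f : Hom M N) (hN : N.ActionsDisjoint) : M.ActionsDisjoint :=
  fun i j m n hi hj => hN i j _ _ (f.map_act i m n hi) (f.map_act j m n hj)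

theorem homCount_eq_zero_of_not_actionsDisjoint (hM : ¬ M.ActionsDisjoint)
    (hN : N.ActionsDisjoint) : homCount M N = 0 :=
  have : IsEmpty (Hom M N) := ⟨fun f => hM (hN.of_hom f)⟩
  Nat.card_of_isEmpty

theorem homVectorEq_isPairTree_iff (hM : M.ActionsDisjoint) (hN : N.ActionsDisjoint) :
    HomVectorEq IsPairTree M N ↔ HomVectorEq IsTree M N := by
  constructor
  · intro h T hfin hT
    have hT := isTree_iff_isArborescence.1 hT
    exact h T hfin (hT.actionsDisjoint.isPairTree_iff_isArborescence.2 hT)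
  · intro h T hfin hT
    by_cases hd : T.ActionsDisjoint
    · exact h T hfin (isTree_iff_isArborescence.2 (hd.isPairTree_iff_isArborescence.1 hT))
    · rw [homCount_eq_zero_of_not_actionsDisjoint hd hM,
        homCount_eq_zero_of_not_actionsDisjoint hd hN]

/-! ### Graded bisimulations -/

/-- A relation between states of `M` and `N` is a graded bisimulation if related states satisfy the
same proposition letters and, for each action, have successors in related pairs. -/
structure IsGradedBisimulation (M : LTS.{uP, uI, u} P I) (N : LTS.{uP, uI, v} P I)
    (R : M.State → N.State → Prop) : Prop where
  prop_iff : ∀ {m n}, R m n → ∀ p, M.prop p m ↔ N.prop p n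
  exists_equiv : ∀ {m n}, R m n → ∀ i,
    ∃ e : {m' // M.act i m m'} ≃ {n' // N.act i n n'}, ∀ m', R m'.1 (e m').1

namespace IsGradedBisimulation

variable {R : M.State → N.State → Prop}

/-- The pairs related by a graded bisimulation, moving along a chosen matching of the successors of
the two components. Both of its projections are coverings. -/
noncomputable def graph (hR : IsGradedBisimulation M N R) (hpt : R M.pt N.pt) :
    LTS.{uP, uI, max u v} P I where
  State := {q : M.State × N.State // R q.1 q.2}
  prop p q := M.prop p q.1.1
  act i q q' := ∃ m' : {m' // M.act i q.1.1 m'},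
    m'.1 = q'.1.1 ∧ ((hR.exists_equiv q.2 i).choose m').1 = q'.1.2
  pt := ⟨(M.pt, N.pt), hpt⟩

variable (hR : IsGradedBisimulation M N R) (hpt : R M.pt N.pt)

/-- The first projection of the graph. -/
def graphFst : Hom (hR.graph hpt) M where
  toFun q := q.1.1
  map_pt := rfl
  map_prop _ _ h := h
  map_act _ _ _ := fun ⟨m', h, _⟩ => h ▸ m'.2

/-- The second projection of the graph. -/
def graphSnd : Hom (hR.graph hpt) N where
  toFun q := q.1.2
  map_pt := rfl
  map_prop p q := (hR.prop_iff q.2 p).1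
  map_act i q _ := fun ⟨_, _, h⟩ => h ▸ ((hR.exists_equiv q.2 i).choose _).2

theorem isCovering_graphFst : IsCovering (hR.graphFst hpt) where
  prop_of_map _ _ h := h
  injOn := by
    rintro i q ⟨⟨_, _⟩, _⟩ ⟨k, rfl, rfl⟩ ⟨⟨_, _⟩, _⟩ ⟨k', rfl, rfl⟩ h
    obtain rfl : k = k' := Subtype.ext h
    rfl
  surjOn i q m hm :=
    ⟨⟨(m, _), (hR.exists_equiv q.2 i).choose_spec ⟨m, hm⟩⟩, ⟨⟨m, hm⟩, rfl, rfl⟩, rfl⟩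

theorem isCovering_graphSnd : IsCovering (hR.graphSnd hpt) where
  prop_of_map p q := (hR.prop_iff q.2 p).2
  injOn := by
    rintro i q ⟨⟨_, _⟩, _⟩ ⟨k, rfl, rfl⟩ ⟨⟨_, _⟩, _⟩ ⟨k', rfl, rfl⟩ h
    obtain rfl : k = k' := (hR.exists_equiv q.2 i).choose.injective (Subtype.ext h)
    rfl
  surjOn i q n hn := by
    obtain ⟨⟨m, hm⟩, e⟩ := (hR.exists_equiv q.2 i).choose.surjective ⟨n, hn⟩
    have hmn := (hR.exists_equiv q.2 i).choose_spec ⟨m, hm⟩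
    rw [e] at hmn
    exact ⟨⟨(m, n), hmn⟩, ⟨⟨m, hm⟩, rfl, congrArg Subtype.val e⟩, rfl⟩

include hR hpt in
theorem isomorphic_unravel : Isomorphic M.unravel N.unravel :=
  (hR.isCovering_graphFst hpt).isomorphic_unravel.symm.trans
    (hR.isCovering_graphSnd hpt).isomorphic_unravel

theorem of_finsum_monoidHom_eq {A L : Type*} [MulOneClass A] [CommRing L] [IsDomain L]
    [CharZero L] [∀ i m, Finite {m' // M.act i m m'}] [∀ i n, Finite {n' // N.act i n n'}]
    (χ : M.State → A →* L) (ψ : N.State → A →* L)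
    (hprop : ∀ {m n}, χ m = ψ n → ∀ p, M.prop p m ↔ N.prop p n)
    (hsum : ∀ {m n}, χ m = ψ n → ∀ i a,
      ∑ᶠ m' : {m' // M.act i m m'}, χ m' a = ∑ᶠ n' : {n' // N.act i n n'}, ψ n' a) :
    IsGradedBisimulation M N fun m n => χ m = ψ n where
  prop_iff := hprop
  exists_equiv {m n} h i := by
    obtain ⟨e, he⟩ := exists_equiv_of_finsum_monoidHom_eq
      (fun m' : {m' // M.act i m m'} => χ m') (fun n' : {n' // N.act i n n'} => ψ n') (hsum h i)
    exact ⟨e, fun m' => (he m').symm⟩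

end IsGradedBisimulation

/-! ### Graded modal equivalence as a graded bisimulation -/

open Classical in
/-- The truth values of lists of formulas at a state, as a multiplicative function. -/
noncomputable def truth (M : LTS.{uP, uI, u} P I) (m : M.State) :
    FreeMonoid (GMLFormula P I) →* ℤ :=
  FreeMonoid.lift fun φ => if M.Sat φ m then 1 else 0

open Classical in
theorem truth_apply (m : M.State) (w : FreeMonoid (GMLFormula P I)) :
    M.truth m w = if M.Sat (.conj w) m then 1 else 0 := by
  induction w using FreeMonoid.inductionOn' with
  | one => simp [GMLFormula.conj, Sat]
  | of_mul φ w ih =>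
    rw [map_mul, ih, truth, FreeMonoid.lift_eval_of, ite_zero_mul_ite_zero, mul_one]
    exact if_congr Iff.rfl rfl rfl

theorem truth_eq_truth_iff {m : M.State} {n : N.State} :
    M.truth m = N.truth n ↔ ∀ φ, M.Sat φ m ↔ N.Sat φ n := by
  classical
  constructor
  · intro h φ
    have := DFunLike.congr_fun h (.of φ)
    simp only [truth, FreeMonoid.lift_eval_of] at this
    split_ifs at this <;> simp_all
  · intro h
    ext w
    simp [truth_apply, h]

theorem encard_act_sat_eq {m : M.State} {n : N.State} (h : ∀ φ, M.Sat φ m ↔ N.Sat φ n) (i : I)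
    (φ : GMLFormula P I) :
    {m' | M.act i m m' ∧ M.Sat φ m'}.encard = {n' | N.act i n n' ∧ N.Sat φ n'}.encard := by
  refine ENat.eq_of_forall_natCast_le_iff fun k => ?_
  rcases k.eq_zero_or_pos with rfl | hk
  · simp
  · exact h (.gdia i ⟨k, hk⟩ φ)

theorem finsum_truth_eq_ncard (i : I) (m : M.State) [Finite {m' // M.act i m m'}]
    (w : FreeMonoid (GMLFormula P I)) :
    ∑ᶠ m' : {m' // M.act i m m'}, M.truth m' w =
      {m' | M.act i m m' ∧ M.Sat (.conj w) m'}.ncard := by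
  classical
  cases nonempty_fintype {m' // M.act i m m'}
  simp only [finsum_eq_sum_of_fintype, truth_apply, Finset.sum_boole]
  rw [← Set.ncard_coe_finset, ← Set.ncard_image_of_injective _ Subtype.val_injective]
  congr
  ext
  simp [and_comm]

theorem isGradedBisimulation_truth [∀ i m, Finite {m' // M.act i m m'}]
    [∀ i n, Finite {n' // N.act i n n'}] :
    IsGradedBisimulation M N fun m n => M.truth m = N.truth n := by
  refine .of_finsum_monoidHom_eq _ _ (fun h p => truth_eq_truth_iff.1 h (.prop p)) fun h i w => ?_
  rw [finsum_truth_eq_ncard, finsum_truth_eq_ncard, Set.ncard, Set.ncard,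
    encard_act_sat_eq (truth_eq_truth_iff.1 h)]

theorem GMLEquiv.isomorphic_unravel [∀ i m, Finite {m' // M.act i m m'}]
    [∀ i n, Finite {n' // N.act i n n'}] (h : GMLEquiv M N) :
    Isomorphic M.unravel N.unravel :=
  isGradedBisimulation_truth.isomorphic_unravel (truth_eq_truth_iff.2 h)

/-! ### Finite trees -/

/-- The same structure with another distinguished state. -/
def withPt (M : LTS.{uP, uI, u} P I) (m : M.State) : LTS.{uP, uI, u} P I := { M with pt := m }

/-- The one-state structure in which nothing holds. -/
def point (P : Type uP) (I : Type uI) : LTS.{uP, uI, 0} P I where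
  State := Unit
  prop _ _ := False
  act _ _ _ := False
  pt := ()

/-- `T` with `p` made true at the root. -/
def mark (p : P) (T : LTS.{uP, uI, u} P I) : LTS.{uP, uI, u} P I :=
  { T with prop := fun q m => T.prop q m ∨ (q = p ∧ m = T.pt) }

/-- `T` with `S` attached to the root by an `i`-transition. -/
def attach (i : I) (S T : LTS.{uP, uI, u} P I) : LTS.{uP, uI, u} P I where
  State := T.State ⊕ S.State
  prop q := Sum.elim (T.prop q) (S.prop q)
  act j
    | .inl m, .inl n => T.act j m n
    | .inr m, .inr n => S.act j m n
    | .inl m, .inr n => j = i ∧ m = T.pt ∧ n = S.pt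
    | .inr _, .inl _ => False
  pt := .inl T.pt

theorem isArborescence_point : (point P I).IsArborescence :=
  ⟨fun _ => .refl, fun _ _ h => h, fun h => h.elim⟩

theorem IsArborescence.mark (hM : M.IsArborescence) (p : P) : (M.mark p).IsArborescence :=
  ⟨hM.reachable, hM.not_act_pt, hM.act_unique⟩

theorem IsArborescence.attach {S T : LTS.{uP, uI, u} P I} (hS : S.IsArborescence)
    (hT : T.IsArborescence) (i : I) : (attach i S T).IsArborescence where
  reachable := by
    rintro (t | s)
    · exact (hT.reachable t).lift Sum.inl fun _ _ ⟨j, h⟩ => ⟨j, h⟩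
    · have h : (LTS.attach i S T).act i (.inl T.pt) (.inr S.pt) := ⟨rfl, rfl, rfl⟩
      exact .head ⟨i, h⟩ <|
        (hS.reachable s).lift Sum.inr fun _ _ ⟨j, h⟩ => ⟨j, h⟩
  not_act_pt := by
    rintro j (t | s) h
    · exact hT.not_act_pt _ _ h
    · exact h
  act_unique := by
    rintro j k (t | s) (t' | s') (t'' | s'') h h'
    · exact (hT.act_unique h h').imp_right (congrArg Sum.inl)
    · exact ⟨h.1.trans h'.1.symm, congrArg Sum.inl (h.2.1.trans h'.2.1.symm)⟩
    · exact h'.elim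
    · exact absurd (h.2.2 ▸ h') (hS.not_act_pt _ _)
    · exact h.elim
    · exact absurd (h'.2.2 ▸ h) (hS.not_act_pt _ _)
    · exact h.elim
    · exact (hS.act_unique h h').imp_right (congrArg Sum.inr)

/-! ### Counting homomorphisms from finite trees -/

/-- A homomorphism from the one-state tree is determined by the distinguished state. -/
def homPointEquiv (M : LTS.{uP, uI, u} P I) : Hom (point P I) M ≃ Unit where
  toFun _ := ()
  invFun _ := ⟨fun _ => M.pt, rfl, fun _ _ h => h.elim, fun _ _ _ h => h.elim⟩
  left_inv f := Hom.ext (funext fun _ => f.map_pt.symm)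
  right_inv _ := rfl

/-- A homomorphism from a marked tree is one from the tree, given that the mark is respected. -/
def homMarkEquiv (p : P) (T : LTS.{uP, uI, w} P I) (M : LTS.{uP, uI, u} P I) :
    Hom (T.mark p) M ≃ PLift (M.prop p M.pt) × Hom T M where
  toFun f := ⟨⟨f.map_pt ▸ f.map_prop p T.pt (.inr ⟨rfl, rfl⟩)⟩,
    ⟨f.toFun, f.map_pt, fun q t h => f.map_prop q t (.inl h), f.map_act⟩⟩
  invFun a := ⟨a.2.toFun, a.2.map_pt, by
    rintro q t (h | ⟨rfl, rfl⟩)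
    · exact a.2.map_prop q t h
    · rw [a.2.map_pt]
      exact a.1.down, a.2.map_act⟩
  left_inv _ := rfl
  right_inv _ := rfl

/-- A homomorphism from `attach i S T` amounts to a homomorphism from `T` together with an
`i`-successor of the distinguished state and a homomorphism from `S` sending the root to it. -/
def homAttachEquiv (i : I) (S T : LTS.{uP, uI, w} P I) (M : LTS.{uP, uI, u} P I) :
    Hom (attach i S T) M ≃ (Σ m : {m // M.act i M.pt m}, Hom S (M.withPt m)) × Hom T M where
  toFun f :=
    ⟨⟨⟨f.toFun (.inr S.pt), f.map_pt ▸ f.map_act i (.inl T.pt) (.inr S.pt) ⟨rfl, rfl, rfl⟩⟩,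
      ⟨f.toFun ∘ .inr, rfl, fun p s => f.map_prop p (.inr s),
        fun j s t => f.map_act j (.inr s) (.inr t)⟩⟩,
      ⟨f.toFun ∘ .inl, f.map_pt, fun p t => f.map_prop p (.inl t),
        fun j s t => f.map_act j (.inl s) (.inl t)⟩⟩
  invFun a :=
    { toFun := Sum.elim a.2.toFun a.1.2.toFun
      map_pt := a.2.map_pt
      map_prop := by
        rintro p (t | s) h
        · exact a.2.map_prop p t h
        · exact a.1.2.map_prop p s h
      map_act := by
        rintro j (t | s) (t' | s') h
        · exact a.2.map_act j t t' h
        · obtain ⟨rfl, rfl, rfl⟩ := h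
          simpa [a.2.map_pt, a.1.2.map_pt, withPt] using a.1.1.2
        · exact h.elim
        · exact a.1.2.map_act j s s' h }
  left_inv f := by ext (t | s) <;> rfl
  right_inv := by
    rintro ⟨⟨⟨m, hm⟩, f, hf, hprop, hact⟩, g⟩
    change S.State → M.State at f
    obtain rfl : f S.pt = m := hf
    rfl

theorem homCount_point (M : LTS.{uP, uI, u} P I) : homCount (point P I) M = 1 := by
  rw [homCount, Nat.card_congr (homPointEquiv M), Nat.card_unique]

theorem homCount_mark (p : P) (T : LTS.{uP, uI, w} P I) (M : LTS.{uP, uI, u} P I) :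
    homCount (T.mark p) M = Nat.card (PLift (M.prop p M.pt)) * homCount T M := by
  rw [homCount, Nat.card_congr (homMarkEquiv p T M), Nat.card_prod, homCount]

theorem homCount_attach (i : I) (S T : LTS.{uP, uI, w} P I) (M : LTS.{uP, uI, u} P I) :
    homCount (attach i S T) M =
      Nat.card (Σ m : {m // M.act i M.pt m}, Hom S (M.withPt m)) * homCount T M := by
  rw [homCount, Nat.card_congr (homAttachEquiv i S T M), Nat.card_prod, homCount]

/-- Codes for finite trees, listing the proposition letters and the labelled immediate subtrees at
the root. -/
inductive TreeCode (P : Type uP) (I : Type uI) where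
  | nil : TreeCode P I
  | mark (p : P) (t : TreeCode P I) : TreeCode P I
  | attach (i : I) (s t : TreeCode P I) : TreeCode P I

namespace TreeCode

/-- The tree described by a code. -/
def toLTS : TreeCode P I → LTS.{uP, uI, 0} P I
  | nil => point P I
  | mark p t => t.toLTS.mark p
  | attach i s t => s.toLTS.attach i t.toLTS

theorem isTree_toLTS (t : TreeCode P I) : t.toLTS.IsTree := by
  refine isTree_iff_isArborescence.2 ?_
  induction t with
  | nil => exact isArborescence_point
  | mark p _ ht => exact ht.mark p
  | attach i _ _ hs ht => exact hs.attach ht i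

theorem finite_toLTS (t : TreeCode P I) : Finite t.toLTS.State := by
  induction t with
  | nil => exact inferInstanceAs (Finite Unit)
  | mark _ _ ht => exact ht
  | attach _ s t _ _ => exact inferInstanceAs (Finite (t.toLTS.State ⊕ s.toLTS.State))

theorem finite_hom (t : TreeCode P I) [∀ i m, Finite {m' // M.act i m m'}] (m : M.State) :
    Finite (Hom t.toLTS (M.withPt m)) := by
  induction t generalizing m with
  | nil => exact .of_equiv _ (homPointEquiv _).symm
  | mark p t ht =>
    have := ht m
    exact .of_equiv _ (homMarkEquiv p t.toLTS _).symm
  | attach i s t hs ht =>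
    have := ht m
    have (m' : {m' // M.act i m m'}) := hs m'.1
    exact .of_equiv ((Σ m' : {m' // M.act i m m'}, Hom s.toLTS (M.withPt m'.1)) × _)
      (homAttachEquiv i s.toLTS t.toLTS (M.withPt m)).symm

/-- Gluing of two trees at their roots. -/
def append : TreeCode P I → TreeCode P I → TreeCode P I
  | nil, t' => t'
  | mark p t, t' => mark p (t.append t')
  | attach i s t, t' => attach i s (t.append t')

instance : MulOneClass (TreeCode P I) where
  one := nil
  mul := append
  one_mul _ := rfl
  mul_one t := by
    change t.append nil = t
    induction t with
    | nil => rfl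
    | mark p _ ht => exact congrArg (mark p) ht
    | attach i s _ _ ht => exact congrArg (attach i s) ht

theorem homCount_append (s t : TreeCode P I) (M : LTS.{uP, uI, u} P I) :
    homCount (s.append t).toLTS M = homCount s.toLTS M * homCount t.toLTS M := by
  induction s with
  | nil => simp only [append, toLTS, homCount_point, one_mul]
  | mark p _ hs => simp only [append, toLTS, homCount_mark, hs, mul_assoc]
  | attach i _ _ _ hs => simp only [append, toLTS, homCount_attach, hs, mul_assoc]

/-- The numbers of homomorphisms from finite trees to the structure pointed at `m`, as a
multiplicative function of the tree. -/
noncomputable def homCountHom (m : M.State) : TreeCode P I →* ℤ where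
  toFun t := homCount t.toLTS (M.withPt m)
  map_one' := mod_cast homCount_point (M.withPt m)
  map_mul' s t := mod_cast homCount_append s t (M.withPt m)

theorem homCountHom_mark_one_pos_iff (p : P) (m : M.State) :
    0 < homCountHom m (mark p 1) ↔ M.prop p m := by
  change 0 < (homCount ((point P I).mark p) (M.withPt m) : ℤ) ↔ _
  rw [homCount_mark, homCount_point, mul_one, Nat.cast_pos, Finite.card_pos_iff]
  exact ⟨fun ⟨h⟩ => h.down, fun h => ⟨⟨h⟩⟩⟩

theorem homCountHom_attach_one [∀ i m, Finite {m' // M.act i m m'}] (i : I) (t : TreeCode P I)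
    (m : M.State) :
    homCountHom m (attach i t 1) = ∑ᶠ m' : {m' // M.act i m m'}, homCountHom m'.1 t := by
  cases nonempty_fintype {m' // M.act i m m'}
  have (m' : {m' // M.act i m m'}) := t.finite_hom m'.1
  have count_eq : homCount (LTS.attach i t.toLTS (point P I)) (M.withPt m) =
      Nat.card (Σ m' : {m' // M.act i m m'}, Hom t.toLTS (M.withPt m'.1)) := by
    rw [homCount_attach, homCount_point, mul_one]
    rfl
  rw [finsum_eq_sum_of_fintype]
  exact (congrArg Nat.cast (count_eq.trans Nat.card_sigma)).trans (Nat.cast_sum _ _)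

end TreeCode

theorem isGradedBisimulation_homCountHom [∀ i m, Finite {m' // M.act i m m'}]
    [∀ i n, Finite {n' // N.act i n n'}] :
    IsGradedBisimulation M N fun m n => TreeCode.homCountHom m = TreeCode.homCountHom n := by
  refine .of_finsum_monoidHom_eq _ _ (fun {m n} h p => ?_) fun {m n} h i t => ?_
  · rw [← TreeCode.homCountHom_mark_one_pos_iff, h, TreeCode.homCountHom_mark_one_pos_iff]
  · rw [← TreeCode.homCountHom_attach_one, h, TreeCode.homCountHom_attach_one]

theorem HomVectorEq.isomorphic_unravel [∀ i m, Finite {m' // M.act i m m'}]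
    [∀ i n, Finite {n' // N.act i n n'}] (h : HomVectorEq IsTree M N) :
    Isomorphic M.unravel N.unravel :=
  isGradedBisimulation_homCountHom.isomorphic_unravel <| MonoidHom.ext fun t =>
    congrArg Nat.cast (h t.toLTS t.finite_toLTS t.isTree_toLTS)

end LTS

open LTS in
/-- Finite branching along each single action is enough for a finite tree to have only finitely many
homomorphisms to `M` and `N`, so `homCount` takes no junk value here. -/
theorem mainTheorem8_general {P : Type uP} {I : Type uI} (M : LTS.{uP, uI, u} P I)
    (N : LTS.{uP, uI, v} P I) (hM : ∀ i m, {m' | M.act i m m'}.Finite)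
    (hN : ∀ i n, {n' | N.act i n n'}.Finite) :
    [HomVectorEq IsTree M N, Isomorphic M.unravel N.unravel, GMLEquiv M N].TFAE ∧
    (M.ActionsDisjoint → N.ActionsDisjoint →
      [HomVectorEq IsPairTree M N, Isomorphic M.stateUnravel N.stateUnravel,
        GMLEquiv M N].TFAE) := by
  have (i : I) (m : M.State) : Finite {m' // M.act i m m'} := (hM i m).to_subtype
  have (i : I) (n : N.State) : Finite {n' // N.act i n n'} := (hN i n).to_subtype
  have h : [HomVectorEq IsTree M N, Isomorphic M.unravel N.unravel, GMLEquiv M N].TFAE := by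
    tfae_have 1 → 2 := HomVectorEq.isomorphic_unravel
    tfae_have 2 → 1 := homVectorEq_isTree_of_isomorphic_unravel
    tfae_have 2 → 3 := gmlEquiv_of_isomorphic_unravel
    tfae_have 3 → 2 := GMLEquiv.isomorphic_unravel
    tfae_finish
  refine ⟨h, fun dM dN => ?_⟩
  rwa [homVectorEq_isPairTree_iff dM dN, isomorphic_stateUnravel_iff dM dN]

theorem mainTheorem8 {P : Type uP} {I : Type uI} [Finite P] [Finite I]
    (M : LTS.{uP, uI, u} P I) (N : LTS.{uP, uI, v} P I)
    (hM : M.ImageFinite) (hN : N.ImageFinite) :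
    [ LTS.HomVectorEq LTS.IsTree M N,
      LTS.Isomorphic M.unravel N.unravel,
      LTS.GMLEquiv M N ].TFAE ∧
    (M.ActionsDisjoint → N.ActionsDisjoint →
      [ LTS.HomVectorEq LTS.IsPairTree M N,
        LTS.Isomorphic M.stateUnravel N.stateUnravel,
        LTS.GMLEquiv M N ].TFAE) :=
  mainTheorem8_general M N (fun i m => (hM m).subset fun _ h => ⟨i, h⟩)
    fun i n => (hN n).subset fun _ h => ⟨i, h⟩
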